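/- Let $b_1,\dots,b_n\in\mathbb{Z}^m$ and let $B=\{b_1,\dots,b_n\}$. For $S\subseteq\mathbb{Z}^m$ let $\mathrm{cone}(S)\subseteq\mathbb{R}^m$ be the set of all finite non-negative real combinations of vectors in $S$. Call $B$ supernormal if, for every subset $B'\subseteq B$, every lattice point in $\mathrm{cone}(B')$ is a non-negative integer combination of vectors in $B\cap\mathrm{cone}(B')$. For $c\in\mathbb{Z}^n$ let $P_c=\{x\in\mathbb{R}^m : b_i\cdot x\le c_i \text{ for } i=1,\dots,n\}$. The system $b_i\cdot x\le c_i$ $(i=1,\dots,n)$ is called tight if $P_{c-e_i}\cap\mathbb{Z}^m\subsetneq P_c\cap\mathbb{Z}^m$ for every unit vector $e_i\in\mathbb{Z}^n$ (equivalently, for each $i$ there is a lattice point $x\in P_c$ with $b_i\cdot x=c_i$). It is called totally dual integral if, for every $w\in\mathbb{Z}^m$ such that $\max\{w\cdot x : x\in P_c\}$ exists (is finite and attained), the dual linear program $\min\{\sum_i y_ic_i : y\in\mathbb{R}^n,\ y\ge 0,\ \sum_i y_ib_i=w\}$ has an optimal solution $y\in\mathbb{Z}^n$. Then $B$ is supernormal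 if and only if, for every $c\in\mathbb{Z}^n$ for which the system $b_i\cdot x\le c_i$ $(i=1,\dots,n)$ is tight, this system is totally dual integral. -/

import Mathlib

open scoped Matrix

namespace VectorConfig

/-- A lattice point of `ℤ^m` regarded as a point of `ℝ^m`. -/
def toReal {m : ℕ} (z : Fin m → ℤ) : Fin m → ℝ := fun j => (z j : ℝ)

/-- `cone(S) ⊆ ℝ^m`: all finite non-negative real combinations of the vectors in `S ⊆ ℤ^m`. -/
def cone {m : ℕ} (S : Set (Fin m → ℤ)) : PointedCone ℝ (Fin m → ℝ) :=
  PointedCone.hull ℝ (toReal '' S)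

/-- `B` is supernormal: for every subset `B'` of `B`, every lattice point of `cone(B')` is a
non-negative integer combination of `B ∩ cone(B')`. -/
def IsSupernormal {m : ℕ} (B : Set (Fin m → ℤ)) : Prop :=
  ∀ B' : Set (Fin m → ℤ), B' ⊆ B → ∀ z : Fin m → ℤ, toReal z ∈ cone B' →
    z ∈ AddSubmonoid.closure {v : Fin m → ℤ | v ∈ B ∧ toReal v ∈ cone B'}

/-- The polyhedron `P_c = {x ∈ ℝ^m : b_i · x ≤ c_i for all i}`. -/
def polyhedron {m n : ℕ} (b : Fin n → Fin m → ℤ) (c : Fin n → ℤ) : Set (Fin m → ℝ) :=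
  {x | ∀ i, toReal (b i) ⬝ᵥ x ≤ (c i : ℝ)}

/-- The set `P_c ∩ ℤ^m` of lattice points of `P_c`. -/
def latticePoints {m n : ℕ} (b : Fin n → Fin m → ℤ) (c : Fin n → ℤ) : Set (Fin m → ℤ) :=
  {z | toReal z ∈ polyhedron b c}

/-- The system `b_i · x ≤ c_i` is tight: lowering any single right-hand side `c_i` by one
strictly decreases the set of lattice points. -/
def IsTight {m n : ℕ} (b : Fin n → Fin m → ℤ) (c : Fin n → ℤ) : Prop :=
  ∀ i : Fin n, latticePoints b (c - Pi.single i 1) ⊂ latticePoints b c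

/-- Real vectors feasible for the dual program: `y ≥ 0` and `∑ i, y_i b_i = w`. -/
def dualFeasible {m n : ℕ} (b : Fin n → Fin m → ℤ) (w : Fin m → ℤ) : Set (Fin n → ℝ) :=
  {y | 0 ≤ y ∧ ∑ i, y i • toReal (b i) = toReal w}

/-- The system `b_i · x ≤ c_i` is totally dual integral: whenever `w ∈ ℤ^m` and
`max {w · x : x ∈ P_c}` is attained, the dual program
`min {y · c : y ≥ 0, ∑ i, y_i b_i = w}` (over real `y`) has an integral optimal solution. -/
def IsTDI {m n : ℕ} (b : Fin n → Fin m → ℤ) (c : Fin n → ℤ) : Prop :=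
  ∀ w : Fin m → ℤ,
    (∃ x ∈ polyhedron b c, IsMaxOn (fun x' => toReal w ⬝ᵥ x') (polyhedron b c) x) →
    ∃ y : Fin n → ℤ, toReal y ∈ dualFeasible b w ∧
      IsMinOn (fun y' => y' ⬝ᵥ toReal c) (dualFeasible b w) (toReal y)

end VectorConfig

namespace VectorConfig

variable {m n : ℕ}

/-! Complementary slackness turns dual optimality into a statement about cones: if `x` maximises `w`
over `P_c`, then `w` lies in the cone of the active normals, and a dual solution supported on
constraints active at `x` is optimal. Tightness makes every `b i` in that cone active
(`IsTight.active_of_mem_cone`), so the integer combination given by supernormality is an optimal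
dual solution. Conversely, every `cone S` with `S ⊆ B` is realised by a tight system with `c ≥ 0`
vanishing exactly on the normals in the cone (`exists_isTight_active_iff`). An integral dual optimum
for a lattice point of the cone then has cost 0, so it uses only those normals. -/

lemma toReal_sub_smul (s t : ℤ) (u v : Fin m → ℤ) :
    toReal (s • u - t • v) = (s : ℝ) • toReal u - (t : ℝ) • toReal v := by
  ext j; simp [toReal]

lemma toReal_neg (u : Fin m → ℤ) : toReal (-u) = -toReal u := by
  ext j; simp [toReal]

lemma toReal_sum_smul (b : Fin n → Fin m → ℤ) (y : Fin n → ℤ) :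
    toReal (∑ i, y i • b i) = ∑ i, toReal y i • toReal (b i) := by
  ext j; simp [toReal]

lemma toReal_injective : Function.Injective (toReal : (Fin m → ℤ) → Fin m → ℝ) := fun u v h => by
  ext j
  exact Int.cast_injective (congrFun h j)

lemma toReal_dotProduct_toReal (u v : Fin m → ℤ) :
    toReal u ⬝ᵥ toReal v = ((u ⬝ᵥ v : ℤ) : ℝ) := by
  simp [toReal, dotProduct]

lemma mem_latticePoints {b : Fin n → Fin m → ℤ} {c : Fin n → ℤ} {z : Fin m → ℤ} :
    z ∈ latticePoints b c ↔ ∀ i, b i ⬝ᵥ z ≤ c i := by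
  simp [latticePoints, polyhedron, toReal_dotProduct_toReal]

lemma toReal_mem_cone {S : Set (Fin m → ℤ)} {v : Fin m → ℤ} (hv : v ∈ S) : toReal v ∈ cone S :=
  PointedCone.subset_hull (Set.mem_image_of_mem _ hv)

/-- A linear inequality valid on the generators is valid on the cone. -/
lemma dotProduct_le_of_mem_cone {S : Set (Fin m → ℤ)} {x x' : Fin m → ℝ}
    (h : ∀ v ∈ S, toReal v ⬝ᵥ x ≤ toReal v ⬝ᵥ x') {u : Fin m → ℝ} (hu : u ∈ cone S) :
    u ⬝ᵥ x ≤ u ⬝ᵥ x' := by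
  induction hu using Submodule.span_induction with
  | mem u hu =>
    obtain ⟨v, hv, rfl⟩ := hu
    exact h v hv
  | zero => simp
  | add u v _ _ hu hv => simpa [add_dotProduct] using add_le_add hu hv
  | smul t u _ hu =>
    change ((t : ℝ) • u) ⬝ᵥ x ≤ ((t : ℝ) • u) ⬝ᵥ x'
    rw [smul_dotProduct, smul_dotProduct]
    exact mul_le_mul_of_nonneg_left hu t.2

lemma mem_cone_insert {S : Set (Fin m → ℤ)} {a : Fin m → ℤ} {x : Fin m → ℝ} :
    x ∈ cone (insert a S) ↔ ∃ t : ℝ, 0 ≤ t ∧ x - t • toReal a ∈ cone S := by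
  rw [cone, Set.image_insert_eq, PointedCone.hull, Submodule.mem_span_insert]
  constructor
  · rintro ⟨t, z, hz, rfl⟩
    refine ⟨t, t.2, ?_⟩
    have : t • toReal a + z - (t : ℝ) • toReal a = z := add_sub_cancel_left _ _
    rw [this]
    exact hz
  · rintro ⟨t, ht, hx⟩
    exact ⟨⟨t, ht⟩, _, hx, (add_sub_cancel _ _).symm⟩

/-! ### Polyhedral cones: Weyl and Farkas -/

/-- The **Weyl theorem**, integral version: a cone generated by finitely many integral vectors is cut
out by finitely many integral linear inequalities. -/
theorem exists_finite_integral_dual {S : Set (Fin m → ℤ)} (hS : S.Finite) :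
    ∃ F : Set (Fin m → ℤ), F.Finite ∧
      ∀ x : Fin m → ℝ, x ∈ cone S ↔ ∀ f ∈ F, 0 ≤ toReal f ⬝ᵥ x := by
  induction S, hS using Set.Finite.induction_on with
  | empty =>
    have hdot : ∀ (i : Fin m) (x : Fin m → ℝ), toReal (Pi.single i 1) ⬝ᵥ x = x i := fun i x => by
      have : toReal (Pi.single i 1 : Fin m → ℤ) = Pi.single i 1 := by
        ext j
        by_cases h : j = i <;> simp [toReal, h]
      rw [this, single_one_dotProduct]
    refine ⟨Set.range (fun i => Pi.single i 1) ∪ Set.range (fun i => -Pi.single i 1),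
      (Set.finite_range _).union (Set.finite_range _), fun x => ?_⟩
    have hx : x ∈ cone (∅ : Set (Fin m → ℤ)) ↔ x = 0 := by simp [cone, PointedCone.hull]
    rw [hx]
    constructor
    · rintro rfl
      simp
    · intro h
      ext i
      have h1 := h _ (Or.inl ⟨i, rfl⟩)
      have h2 := h _ (Or.inr ⟨i, rfl⟩)
      simp only [toReal_neg, neg_dotProduct, hdot] at h1 h2
      simp only [Pi.zero_apply]
      linarith
  | @insert a S _ _ ih =>
    obtain ⟨F, hF, hFS⟩ := ih
    -- Fourier–Motzkin elimination of the coefficient `t ≥ 0` of `a`: each lower bound on `t` (0 or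
    -- from `f ⬝ᵥ a < 0`) is paired with each upper bound (from `0 < f ⬝ᵥ a`).
    refine ⟨{f ∈ F | 0 ≤ f ⬝ᵥ a} ∪
      Set.image2 (fun f g => (f ⬝ᵥ a) • g - (g ⬝ᵥ a) • f) {f ∈ F | 0 < f ⬝ᵥ a} {f ∈ F | f ⬝ᵥ a < 0},
      (hF.sep _).union ((hF.sep _).image2 _ (hF.sep _)), fun x => ?_⟩
    have hdot : ∀ f t, toReal f ⬝ᵥ (x - t • toReal a) =
        toReal f ⬝ᵥ x - t * ((f ⬝ᵥ a : ℤ) : ℝ) := fun f t => by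
      rw [dotProduct_sub, dotProduct_smul, toReal_dotProduct_toReal, smul_eq_mul]
    rw [mem_cone_insert]
    simp only [hFS, hdot]
    constructor
    · rintro ⟨t, ht, h⟩ f (⟨hf, hfa⟩ | ⟨f, ⟨hf, hfa⟩, g, ⟨hg, hga⟩, rfl⟩)
      · have h1 : (0 : ℝ) ≤ ((f ⬝ᵥ a : ℤ) : ℝ) := by exact_mod_cast hfa
        nlinarith [h f hf, mul_nonneg ht h1]
      · have h1 : (0 : ℝ) < ((f ⬝ᵥ a : ℤ) : ℝ) := by exact_mod_cast hfa
        have h2 : ((g ⬝ᵥ a : ℤ) : ℝ) < 0 := by exact_mod_cast hga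
        simp only [toReal_sub_smul, sub_dotProduct, smul_dotProduct, smul_eq_mul]
        linarith [mul_nonneg h1.le (h g hg), mul_nonneg (neg_nonneg.2 h2.le) (h f hf)]
    · intro h
      -- Take `t` to be the largest lower bound.
      obtain ⟨t, ht, hmax⟩ := Set.exists_max_image
        (insert (0 : ℝ) ((fun g : Fin m → ℤ => toReal g ⬝ᵥ x / ((g ⬝ᵥ a : ℤ) : ℝ)) ''
          {f ∈ F | f ⬝ᵥ a < 0})) id
        (((hF.sep _).image _).insert _) ⟨0, Set.mem_insert _ _⟩
      refine ⟨t, hmax 0 (Set.mem_insert _ _), fun f hf => ?_⟩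
      rw [sub_nonneg]
      rcases lt_or_ge (f ⬝ᵥ a) 0 with hfa | hfa
      · have h1 := hmax _ (Set.mem_insert_of_mem _ ⟨f, ⟨hf, hfa⟩, rfl⟩)
        have h2 : ((f ⬝ᵥ a : ℤ) : ℝ) < 0 := by exact_mod_cast hfa
        exact (div_le_iff_of_neg h2).1 h1
      · have h0 := h f (Or.inl ⟨hf, hfa⟩)
        rcases hfa.eq_or_lt with hfa | hfa
        · simpa [← hfa] using h0
        rcases ht with rfl | ⟨g, ⟨hg, hga⟩, rfl⟩
        · simpa using h0
        have h1 := h _ (Or.inr ⟨f, ⟨hf, hfa⟩, g, ⟨hg, hga⟩, rfl⟩)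
        have h2 : ((g ⬝ᵥ a : ℤ) : ℝ) < 0 := by exact_mod_cast hga
        simp only [toReal_sub_smul, sub_dotProduct, smul_dotProduct, smul_eq_mul] at h1
        rw [div_mul_eq_mul_div, div_le_iff_of_neg h2]
        linarith

/-- The **Farkas lemma** with an integral certificate. -/
theorem exists_integral_separator {S : Set (Fin m → ℤ)} (hS : S.Finite) {x : Fin m → ℝ}
    (hx : x ∉ cone S) :
    ∃ d : Fin m → ℤ, (∀ u ∈ cone S, u ⬝ᵥ toReal d ≤ 0) ∧ 0 < x ⬝ᵥ toReal d := by
  obtain ⟨F, -, hF⟩ := exists_finite_integral_dual hS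
  rw [hF] at hx
  push Not at hx
  obtain ⟨f, hf, hfx⟩ := hx
  refine ⟨-f, fun u hu => ?_, ?_⟩
  · have := (hF u).1 hu f hf
    rw [toReal_neg, dotProduct_neg, dotProduct_comm]
    linarith
  · rw [toReal_neg, dotProduct_neg, dotProduct_comm]
    linarith

/-! ### Tight systems and linear programming duality -/

lemma isTight_iff {b : Fin n → Fin m → ℤ} {c : Fin n → ℤ} :
    IsTight b c ↔ ∀ i, ∃ u ∈ latticePoints b c, b i ⬝ᵥ u = c i := by
  refine forall_congr' fun i => ?_
  have hsub : latticePoints b (c - Pi.single i 1) ⊆ latticePoints b c := fun u hu => by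
    rw [mem_latticePoints] at hu ⊢
    intro j
    have := hu j
    by_cases h : j = i
    · subst h
      simp at this
      omega
    · simpa [h] using this
  rw [Set.ssubset_iff_exists, and_iff_right hsub]
  refine exists_congr fun u => and_congr_right fun hu => ?_
  rw [mem_latticePoints] at hu ⊢
  constructor
  · intro h
    push Not at h
    obtain ⟨j, hj⟩ := h
    have := hu j
    by_cases hji : j = i
    · subst hji
      simp at hj
      omega
    · simp [hji] at hj
      omega
  · intro h h'
    have := h' i
    simp at this
    omega

/-- Replacing each right-hand side by the maximum attained on lattice points makes a system tight
without changing its lattice points. -/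
lemma exists_isTight (b : Fin n → Fin m → ℤ) (r : Fin n → ℤ) (hr : (latticePoints b r).Nonempty) :
    ∃ c, IsTight b c ∧ c ≤ r ∧ latticePoints b c = latticePoints b r := by
  have hmax : ∀ i, ∃ k : ℤ, (∃ u ∈ latticePoints b r, b i ⬝ᵥ u = k) ∧
      ∀ k', (∃ u ∈ latticePoints b r, b i ⬝ᵥ u = k') → k' ≤ k := fun i => by
    obtain ⟨u, hu⟩ := hr
    refine Int.exists_greatest_of_bdd ⟨r i, ?_⟩ ⟨_, u, hu, rfl⟩
    rintro _ ⟨v, hv, rfl⟩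
    exact mem_latticePoints.1 hv i
  choose c hc hcmax using hmax
  have hcr : c ≤ r := fun i => by
    obtain ⟨u, hu, hui⟩ := hc i
    exact hui ▸ mem_latticePoints.1 hu i
  have heq : latticePoints b c = latticePoints b r := by
    ext u
    refine ⟨fun hu => ?_, fun hu => ?_⟩
    · exact mem_latticePoints.2 fun i => (mem_latticePoints.1 hu i).trans (hcr i)
    · exact mem_latticePoints.2 fun i => hcmax i _ ⟨u, hu, rfl⟩
  exact ⟨c, isTight_iff.2 fun i => heq ▸ hc i, hcr, heq⟩

/-- The objective of a linear program attaining its maximum at `x` lies in the cone generated by the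
normals of the constraints active at `x`. -/
lemma mem_cone_active_of_isMaxOn (b : Fin n → Fin m → ℤ) (c : Fin n → ℤ) {w x : Fin m → ℝ}
    (hx : x ∈ polyhedron b c) (hmax : IsMaxOn (fun x' => w ⬝ᵥ x') (polyhedron b c) x) :
    w ∈ cone (b '' {i | toReal (b i) ⬝ᵥ x = c i}) := by
  by_contra hw
  obtain ⟨d, hd, hwd⟩ := exists_integral_separator (Set.toFinite _) hw
  -- A short move along `d` stays feasible: active constraints do not increase, the others have
  -- slack. It would improve the objective.
  have hev : ∀ᶠ t : ℝ in nhdsWithin 0 (Set.Ioi 0),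
      ∀ i, toReal (b i) ⬝ᵥ (x + t • toReal d) ≤ c i := by
    rw [Filter.eventually_all]
    intro i
    simp only [dotProduct_add, dotProduct_smul, smul_eq_mul]
    rcases (hx i).eq_or_lt with hi | hi
    · filter_upwards [self_mem_nhdsWithin] with t ht
      have := hd _ (toReal_mem_cone (Set.mem_image_of_mem b (show i ∈ {i | _} from hi)))
      have ht' : (0 : ℝ) < t := ht
      nlinarith
    · have hcont : Filter.Tendsto
          (fun t : ℝ => toReal (b i) ⬝ᵥ x + t * (toReal (b i) ⬝ᵥ toReal d)) (nhds 0)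
          (nhds (toReal (b i) ⬝ᵥ x + 0 * (toReal (b i) ⬝ᵥ toReal d))) :=
        Continuous.tendsto (by fun_prop) 0
      rw [zero_mul, add_zero] at hcont
      filter_upwards [nhdsWithin_le_nhds (hcont.eventually_lt_const hi)] with t ht using ht.le
  obtain ⟨t, ht, ht0⟩ := (hev.and self_mem_nhdsWithin).exists
  have h : w ⬝ᵥ (x + t • toReal d) ≤ w ⬝ᵥ x := hmax ht
  rw [dotProduct_add, dotProduct_smul, smul_eq_mul] at h
  have := mul_pos (show (0 : ℝ) < t from ht0) hwd
  linarith

lemma exists_nonneg_coeff_of_mem_cone (b : Fin n → Fin m → ℤ) {S : Set (Fin m → ℤ)}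
    (hS : S ⊆ Set.range b) {u : Fin m → ℝ} (hu : u ∈ cone S) :
    ∃ y : Fin n → ℝ, 0 ≤ y ∧ (∀ i, y i ≠ 0 → b i ∈ S) ∧ ∑ i, y i • toReal (b i) = u := by
  induction hu using Submodule.span_induction with
  | mem u hu =>
    obtain ⟨v, hv, rfl⟩ := hu
    obtain ⟨i, rfl⟩ := hS hv
    refine ⟨Pi.single i 1, Pi.single_nonneg.2 zero_le_one, fun j hj => ?_, ?_⟩
    · by_cases h : j = i
      · exact h ▸ hv
      · simp [h] at hj
    · simp [Pi.single_apply]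
  | zero => exact ⟨0, le_rfl, by simp, by simp⟩
  | add u v _ _ hu hv =>
    obtain ⟨y, hy, hyS, rfl⟩ := hu
    obtain ⟨y', hy', hyS', rfl⟩ := hv
    refine ⟨y + y', add_nonneg hy hy', fun i hi => ?_, by simp [add_smul, Finset.sum_add_distrib]⟩
    by_cases h : y i = 0
    · exact hyS' i fun h' => hi (by simp [h, h'])
    · exact hyS i h
  | smul t u _ hu =>
    obtain ⟨y, hy, hyS, rfl⟩ := hu
    refine ⟨(t : ℝ) • y, smul_nonneg t.2 hy, fun i hi => hyS i fun h => hi (by simp [h]), ?_⟩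
    rw [Finset.smul_sum]
    refine Finset.sum_congr rfl fun i _ => ?_
    rw [Pi.smul_apply, smul_assoc]
    rfl

lemma exists_nonneg_coeff_of_mem_closure (b : Fin n → Fin m → ℤ) {S : Set (Fin m → ℤ)}
    (hS : S ⊆ Set.range b) {u : Fin m → ℤ} (hu : u ∈ AddSubmonoid.closure S) :
    ∃ y : Fin n → ℤ, 0 ≤ y ∧ (∀ i, y i ≠ 0 → b i ∈ S) ∧ ∑ i, y i • b i = u := by
  induction hu using AddSubmonoid.closure_induction with
  | mem v hv =>
    obtain ⟨i, rfl⟩ := hS hv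
    refine ⟨Pi.single i 1, Pi.single_nonneg.2 zero_le_one, fun j hj => ?_, ?_⟩
    · by_cases h : j = i
      · exact h ▸ hv
      · simp [h] at hj
    · simp [Pi.single_apply]
  | zero => exact ⟨0, le_rfl, by simp, by simp⟩
  | add u v _ _ hu hv =>
    obtain ⟨y, hy, hyS, rfl⟩ := hu
    obtain ⟨y', hy', hyS', rfl⟩ := hv
    refine ⟨y + y', add_nonneg hy hy', fun i hi => ?_, by simp [add_smul, Finset.sum_add_distrib]⟩
    by_cases h : y i = 0
    · exact hyS' i fun h' => hi (by simp [h, h'])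
    · exact hyS i h

lemma dotProduct_eq_sum_of_dualFeasible {b : Fin n → Fin m → ℤ} {w : Fin m → ℤ} {y : Fin n → ℝ}
    (hy : y ∈ dualFeasible b w) (x : Fin m → ℝ) :
    toReal w ⬝ᵥ x = ∑ i, y i * (toReal (b i) ⬝ᵥ x) := by
  rw [← hy.2, sum_dotProduct]
  simp [smul_dotProduct]

/-- In a tight system, the normals in the cone of the constraints active at a feasible point belong
to active constraints themselves. -/
lemma IsTight.active_of_mem_cone {b : Fin n → Fin m → ℤ} {c : Fin n → ℤ} (hc : IsTight b c)
    {x : Fin m → ℝ} (hx : x ∈ polyhedron b c) {k : Fin n}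
    (hk : toReal (b k) ∈ cone (b '' {i | toReal (b i) ⬝ᵥ x = c i})) :
    toReal (b k) ⬝ᵥ x = c k := by
  refine le_antisymm (hx k) ?_
  -- On the active normals `u` is bounded by `x`, hence also on `b k`, where `u` attains `c k`.
  obtain ⟨u, hu, huk⟩ := isTight_iff.1 hc k
  rw [← huk, ← toReal_dotProduct_toReal]
  refine dotProduct_le_of_mem_cone ?_ hk
  rintro _ ⟨i, hi, rfl⟩
  exact (hu i).trans_eq (Eq.symm hi)

/-! ### The two implications -/

theorem IsSupernormal.isTDI {b : Fin n → Fin m → ℤ} (hb : IsSupernormal (Set.range b))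
    {c : Fin n → ℤ} (hc : IsTight b c) : IsTDI b c := by
  rintro w ⟨x, hx, hmax⟩
  obtain ⟨y, hy0, hyS, hyw⟩ := exists_nonneg_coeff_of_mem_closure b (fun v hv => hv.1)
    (hb _ (Set.image_subset_range b _) w (mem_cone_active_of_isMaxOn b c hx hmax))
  have hy : toReal y ∈ dualFeasible b w :=
    ⟨fun i => Int.cast_nonneg (hy0 i), by rw [← toReal_sum_smul, hyw]⟩
  refine ⟨y, hy, fun y' hy' => ?_⟩
  calc toReal y ⬝ᵥ toReal c = ∑ i, toReal y i * (toReal (b i) ⬝ᵥ x) := by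
        refine Finset.sum_congr rfl fun i _ => ?_
        by_cases h : y i = 0
        · simp [toReal, h]
        · rw [hc.active_of_mem_cone hx (hyS i h).2]
          rfl
    _ = ∑ i, y' i * (toReal (b i) ⬝ᵥ x) := by
        rw [← dotProduct_eq_sum_of_dualFeasible hy, dotProduct_eq_sum_of_dualFeasible hy']
    _ ≤ y' ⬝ᵥ toReal c :=
        Finset.sum_le_sum fun i _ => mul_le_mul_of_nonneg_left (hx i) (hy'.1 i)

/-- A cone generated by some of the normals is the normal cone at the origin of a tight system. -/
lemma exists_isTight_active_iff (b : Fin n → Fin m → ℤ) {S : Set (Fin m → ℤ)} (hS : S.Finite) :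
    ∃ c, IsTight b c ∧ 0 ≤ c ∧ ∀ i, c i = 0 ↔ toReal (b i) ∈ cone S := by
  classical
  have hsep : ∀ k, ∃ d : Fin m → ℤ, (∀ i, toReal (b i) ∈ cone S → b i ⬝ᵥ d ≤ 0) ∧
      (toReal (b k) ∉ cone S → 0 < b k ⬝ᵥ d) := fun k => by
    by_cases hk : toReal (b k) ∈ cone S
    · exact ⟨0, by simp, fun h => absurd hk h⟩
    · obtain ⟨d, hd, hkd⟩ := exists_integral_separator hS hk
      rw [toReal_dotProduct_toReal] at hkd
      refine ⟨d, fun i hi => ?_, fun _ => by exact_mod_cast hkd⟩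
      have := hd _ hi
      rw [toReal_dotProduct_toReal] at this
      exact_mod_cast this
  choose d hd hdk using hsep
  set r : Fin n → ℤ := fun i => if toReal (b i) ∈ cone S then 0 else ∑ k, |b i ⬝ᵥ d k| with hr
  have hr0 : (0 : Fin m → ℤ) ∈ latticePoints b r := mem_latticePoints.2 fun i => by
    rw [dotProduct_zero]
    by_cases h : toReal (b i) ∈ cone S
    · simp [hr, h]
    · simpa [hr, h] using Finset.sum_nonneg fun k _ => abs_nonneg _
  have hrd : ∀ k, d k ∈ latticePoints b r := fun k => mem_latticePoints.2 fun i => by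
    by_cases h : toReal (b i) ∈ cone S
    · simpa [hr, h] using hd k i h
    · simpa [hr, h] using (le_abs_self _).trans
        (Finset.single_le_sum (f := fun k => |b i ⬝ᵥ d k|) (fun k _ => abs_nonneg _)
          (Finset.mem_univ k))
  obtain ⟨c, hc, hcr, heq⟩ := exists_isTight b r ⟨0, hr0⟩
  rw [← heq] at hr0
  have hc0 : 0 ≤ c := fun i => by simpa using mem_latticePoints.1 hr0 i
  refine ⟨c, hc, hc0, fun i => ⟨fun hi => ?_, fun hi => ?_⟩⟩
  · by_contra h
    have := mem_latticePoints.1 (heq ▸ hrd i) i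
    have := hdk i h
    omega
  · refine le_antisymm ?_ (hc0 i)
    simpa [hr, hi] using hcr i

theorem isSupernormal_of_forall_isTDI {b : Fin n → Fin m → ℤ}
    (h : ∀ c : Fin n → ℤ, IsTight b c → IsTDI b c) : IsSupernormal (Set.range b) := by
  intro S hS z hz
  obtain ⟨c, hc, hc0, hcS⟩ := exists_isTight_active_iff b ((Set.finite_range b).subset hS)
  have hmax : IsMaxOn (fun x => toReal z ⬝ᵥ x) (polyhedron b c) 0 := fun x hx => by
    refine dotProduct_le_of_mem_cone (fun v hv => ?_) hz
    obtain ⟨i, rfl⟩ := hS hv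
    have := hx i
    rw [(hcS i).2 (toReal_mem_cone hv)] at this
    simpa using this
  obtain ⟨y, hy, hmin⟩ := h c hc z
    ⟨0, fun i => by simpa using hc0 i, hmax⟩
  -- A real dual solution supported on `S` costs 0, so the integral optimum costs at most 0; its
  -- terms `y i * c i` are nonnegative and hence all vanish.
  obtain ⟨y', hy'0, hy'S, hy'z⟩ := exists_nonneg_coeff_of_mem_cone b hS hz
  have hy'c : y' ⬝ᵥ toReal c = 0 := Finset.sum_eq_zero fun i _ => by
    by_cases hi : y' i = 0
    · simp [hi]
    · simp [toReal, (hcS i).2 (toReal_mem_cone (hy'S i hi))]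
  have hle : toReal y ⬝ᵥ toReal c ≤ 0 := hy'c ▸ hmin (show y' ∈ dualFeasible b z from ⟨hy'0, hy'z⟩)
  have hy0 : ∀ i, 0 ≤ y i := fun i => Int.cast_nonneg_iff.1 (hy.1 i)
  have hyc : ∀ i, y i * c i = 0 := by
    rw [toReal_dotProduct_toReal] at hle
    have hle' : ∑ i, y i * c i ≤ 0 := by exact_mod_cast hle
    have hnn : ∀ i ∈ Finset.univ, 0 ≤ y i * c i := fun i _ => mul_nonneg (hy0 i) (hc0 i)
    intro i
    exact (Finset.sum_eq_zero_iff_of_nonneg hnn).1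
      (le_antisymm hle' (Finset.sum_nonneg hnn)) i (Finset.mem_univ i)
  have hzy : z = ∑ i, y i • b i := toReal_injective (by rw [toReal_sum_smul, hy.2])
  rw [hzy]
  refine AddSubmonoid.sum_mem _ fun i _ => ?_
  rcases mul_eq_zero.1 (hyc i) with hi | hi
  · simp [hi]
  · lift y i to ℕ using hy0 i with k
    rw [natCast_zsmul]
    have hmem : b i ∈ {v | v ∈ Set.range b ∧ toReal v ∈ cone S} := ⟨⟨i, rfl⟩, (hcS i).1 hi⟩
    exact AddSubmonoid.nsmul_mem _ (AddSubmonoid.subset_closure hmem) _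

end VectorConfig

theorem theorem3p6 {m n : ℕ} (b : Fin n → Fin m → ℤ) :
    VectorConfig.IsSupernormal (Set.range b) ↔
      ∀ c : Fin n → ℤ, VectorConfig.IsTight b c → VectorConfig.IsTDI b c :=
  ⟨fun h _ hc => h.isTDI hc, VectorConfig.isSupernormal_of_forall_isTDI⟩
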